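/- Let $k$ be a field of positive characteristic $p$, and let $m,e,s,r,q$ be positive integers with $s=p^rq$, $p\nmid q$, $q>1$, $e>r\ge 1$ and $m>1$. Let $$B=k[X,Y,Z,T]/(X^mY+T^s+Z^{p^e}),$$ and let $y$ denote the image of $Y$ in $B$. Then there is no non-trivial exponential map $\phi$ on $B$ with $y\in B^{\phi}$. Here an exponential map on a $k$-algebra $A$ is a $k$-algebra homomorphism $\phi=\phi_U:A\to A[U]$ ($U$ an indeterminate) such that (i) composing $\phi_U$ with the evaluation $A[U]\to A$ at $U=0$ gives the identity of $A$, and (ii) $\phi_V\phi_U=\phi_{V+U}$ as maps $A\to A[V,U]$, where $\phi_V:A\to A[V]$ is extended to $A[U]\to A[V,U]$ by $\phi_V(U)=U$. Its ring of invariants is $A^{\phi}=\{a\in A\mid\phi(a)=a\}$, and $\phi$ is non-trivial if $A^{\phi}\neq A$. -/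

import Mathlib

open Polynomial

/-- A `k`-algebra homomorphism `φ : A → A[U]` is an exponential map on `A` if
(i) evaluating `φ a` at `U = 0` gives back `a`, and
(ii) `φ_V ∘ φ_U = φ_{V+U}` as maps `A → A[V, U]`, where `φ_V` is extended to `A[U] → A[V, U]` by
`φ_V(U) = U`.
Here `A[V, U]` is modelled by `A[X][X]`: the inner variable `C X` is `V`, the outer one `X` is `U`.
Applying `φ` to every coefficient of a polynomial in `U` is the extension of `φ_V`. -/
structure IsExponentialMap {k A : Type*} [CommRing k] [CommRing A] [Algebra k A]
    (φ : A →ₐ[k] A[X]) : Prop where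
  eval_zero : ∀ a : A, (φ a).eval 0 = a
  comp_eq_add : ∀ a : A,
    (φ a).map (φ : A →+* A[X]) =
      (φ a).eval₂ ((C : A[X] →+* A[X][X]).comp (C : A →+* A[X])) (C X + X)

/-- The ring of invariants `A^φ = {a ∈ A | φ a = a}` (with `a` viewed as a constant polynomial). -/
noncomputable def expInvariants {k A : Type*} [CommRing k] [CommRing A] [Algebra k A]
    (φ : A →ₐ[k] A[X]) : Subalgebra k A :=
  AlgHom.equalizer φ CAlgHom

/-- `φ` is non-trivial if `A^φ ≠ A`. -/
def IsNontrivialExp {k A : Type*} [CommRing k] [CommRing A] [Algebra k A]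
    (φ : A →ₐ[k] A[X]) : Prop :=
  expInvariants φ ≠ ⊤

/-- The polynomial `X^m Y + T^s + Z^n` in `k[X, Y, Z, T]`; the variables `X, Y, Z, T` are
numbered `0, 1, 2, 3`. -/
noncomputable def hypersurfacePoly (k : Type*) [CommRing k] (m s n : ℕ) :
    MvPolynomial (Fin 4) k :=
  MvPolynomial.X 0 ^ m * MvPolynomial.X 1 + MvPolynomial.X 3 ^ s + MvPolynomial.X 2 ^ n

/-- The `k`-algebra `k[X, Y, Z, T] / (X^m Y + T^s + Z^n)`. -/
abbrev HypersurfaceRing (k : Type*) [CommRing k] (m s n : ℕ) : Type _ :=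
  MvPolynomial (Fin 4) k ⧸ Ideal.span {hypersurfacePoly k m s n}

/-- The image `y` of `Y` in `k[X, Y, Z, T] / (X^m Y + T^s + Z^n)`. -/
noncomputable def HypersurfaceRing.y (k : Type*) [CommRing k] (m s n : ℕ) :
    HypersurfaceRing k m s n :=
  Ideal.Quotient.mk (Ideal.span {hypersurfacePoly k m s n}) (MvPolynomial.X 1)

/-! Write `e = r + j` and `w = t^q + z^(p^j)`. Frobenius turns the defining relation into `x^m y =
-w^(p^r)`. The proof shows that `x`, then `w`, is invariant, and that this leaves no room for a
non-trivial map.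

The ideal `(x, w)` is prime: modulo it the ring embeds in `k[Y][τ]` by the cusp `z = -τ^q`, `t =
τ^(p^j)` (`ker_cuspHom`). The key point is `φ x ∈ (x, w)B[U]` (`map_mem_ker_of_pow_mul_eq`). If `p ∣
m`, it follows from the multiplicity of the prime `Y` in the reduced relation. Otherwise it follows
from unique factorization in `B[1/x] = k[x, z, t][1/x]`. A Frobenius power then makes `x` divide
`φ(x)^(p^r)`, and inverting `φ` forces `φ x` to be constant in `U`.

With `w` invariant, `φ z` and `φ t` have degrees `q l` and `p^j l`. If `l > 0`, every orbit degree
lies in `l` times the semigroup generated by `q` and `p^j`. Yet Hasse derivatives produce the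
`p`-part of `l` as an orbit degree, although `1` is not in that semigroup. Here `e > r` enters as
`p^j > 1`. -/

/-! ### Exponential maps: inversion and Hasse derivatives -/

namespace IsExponentialMap

variable {k A : Type*} [CommRing k] [CommRing A] [Algebra k A] {φ : A →ₐ[k] A[X]}

theorem mem_expInvariants {a : A} : a ∈ expInvariants φ ↔ φ a = C a := Iff.rfl

theorem mem_expInvariants_of_natDegree_eq_zero (h : IsExponentialMap φ) {a : A}
    (ha : (φ a).natDegree = 0) : a ∈ expInvariants φ := by
  rw [mem_expInvariants]
  have h1 := eq_C_of_natDegree_eq_zero ha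
  have h2 := h.eval_zero a
  rw [h1, eval_C] at h2
  rw [h1, h2]

theorem injective (h : IsExponentialMap φ) : Function.Injective φ := fun a b hab => by
  rw [← h.eval_zero a, hab, h.eval_zero]

/-- The endomorphism of `A[U]` extending `φ` with `U ↦ -U`. -/
noncomputable def reflection (φ : A →ₐ[k] A[X]) : A[X] →+* A[X] :=
  eval₂RingHom (φ : A →+* A[X]) (-X)

@[simp]
theorem reflection_C (a : A) : reflection φ (C a) = φ a := by simp [reflection]

@[simp]
theorem reflection_X : reflection φ X = -X := by simp [reflection]

/-- Axiom (ii) at `U = -V` reads `φ_V φ_(-V) = φ_0`, which is the identity by axiom (i). -/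
theorem reflection_apply_map (h : IsExponentialMap φ) (a : A) : reflection φ (φ a) = C a := by
  have h1 := congrArg (eval (-X : A[X])) (h.comp_eq_add a)
  rw [eval_map, ← coe_evalRingHom, hom_eval₂] at h1
  have h2 : (evalRingHom (-X : A[X])).comp ((C : A[X] →+* A[X][X]).comp (C : A →+* A[X])) = C := by
    ext; simp
  rw [h2] at h1
  simp only [coe_evalRingHom, eval_add, eval_C, eval_X, add_neg_cancel] at h1
  have h3 : eval₂ C (0 : A[X]) (φ a) = C ((φ a).eval 0) := by
    rw [← C_0, eval₂_at_apply]
  rw [h3, h.eval_zero] at h1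
  exact h1

theorem reflection_reflection (h : IsExponentialMap φ) (f : A[X]) :
    reflection φ (reflection φ f) = f := by
  have : (reflection φ).comp (reflection φ) = RingHom.id _ := by
    ext a
    · simp [h.reflection_apply_map]
    · simp
  exact congrArg (fun g : A[X] →+* A[X] => g f) this

/-- Both sides are the coefficient of `U^i` in axiom (ii); the right side of the axiom is a Taylor
expansion about `V`. -/
theorem map_coeff (h : IsExponentialMap φ) (a : A) (i : ℕ) :
    φ ((φ a).coeff i) = hasseDeriv i (φ a) := by
  have h1 := congrArg (fun f => coeff f i) (h.comp_eq_add a)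
  have h2 : (φ a).eval₂ ((C : A[X] →+* A[X][X]).comp (C : A →+* A[X])) (C X + X)
      = taylor X ((φ a).map C) := by
    rw [taylor_apply, comp, eval₂_map, add_comm]
  simp only [h2, coeff_map, taylor_coeff] at h1
  rw [RingHom.coe_coe] at h1
  rw [h1]
  ext n
  have h3 : hasseDeriv i ((φ a).map (C : A →+* A[X])) = (hasseDeriv i (φ a)).map C := by
    ext1 j
    simp [hasseDeriv_coeff, coeff_map]
  rw [h3, eval_map, eval₂_C_X]

/-- The `p`-part of the degree of an orbit polynomial is again the degree of one. -/
theorem exists_natDegree_eq_pow [IsDomain A] (h : IsExponentialMap φ) {p : ℕ} [Fact p.Prime]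
    [CharP A p] {a : A} {i u : ℕ} (hu : ¬ p ∣ u) (ha : (φ a).natDegree = p ^ i * u) :
    ∃ b, (φ b).natDegree = p ^ i := by
  have hp : p.Prime := Fact.out
  have hu0 : 1 ≤ u := Nat.one_le_iff_ne_zero.2 (by rintro rfl; simp at hu)
  have hle : p ^ i ≤ p ^ i * u := Nat.le_mul_of_pos_right _ hu0
  -- The Hasse derivative of this order brings the top degree down to `p^i` and multiplies the
  -- leading coefficient by `choose (p^i u) (p^i)`, which is `u` modulo `p`, hence nonzero.
  refine ⟨(φ a).coeff (p ^ i * u - p ^ i), ?_⟩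
  rw [h.map_coeff]
  have hchoose : (((p ^ i * u).choose (p ^ i) : ℕ) : A) ≠ 0 := by
    rw [Ne, CharP.cast_eq_zero_iff A p]
    have h1 := Choose.choose_pow_mul_pow_mul_modEq_choose_nat (p := p) (a := u) (b := 1) (k := i)
    rw [mul_one, Nat.choose_one_right] at h1
    rwa [h1.dvd_iff dvd_rfl]
  apply natDegree_eq_of_le_of_coeff_ne_zero
  · refine (natDegree_hasseDeriv_le _ _).trans ?_
    rw [ha]; omega
  · rw [hasseDeriv_coeff]
    have : p ^ i + (p ^ i * u - p ^ i) = p ^ i * u := by omega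
    rw [this, Nat.choose_symm hle]
    refine mul_ne_zero hchoose ?_
    rw [← ha, coeff_natDegree, leadingCoeff_ne_zero]
    rintro h0
    rw [h0, natDegree_zero] at ha
    have := pow_pos hp.pos i
    omega

end IsExponentialMap

/-! ### Degrees in a two-generator semigroup -/

/-- A nonzero term `a(f) h^j` has degree `l (q deg a + n j)`. Since `q` and `n` are coprime, its
quotient by `l` determines `j < q` modulo `q`, so distinct terms have distinct degrees and nothing
cancels. -/
theorem Polynomial.exists_natDegree_eval₂_eval₂ {I G : Type*} [CommRing I] [CommRing G] [IsDomain G]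
    {κ : I →+* G} (hκ : Function.Injective κ) {f h : G[X]} {q n l : ℕ} (hq : 0 < q) (hn : 0 < n)
    (hl : 0 < l) (hqn : q.Coprime n) (hf : f.natDegree = q * l) (hh : h.natDegree = n * l)
    {g : I[X][X]} (hg : g ≠ 0) (hdeg : g.natDegree < q) :
    g.eval₂ (eval₂RingHom (C.comp κ) f) h ≠ 0 ∧
      ∃ i j, (g.eval₂ (eval₂RingHom (C.comp κ) f) h).natDegree = l * (q * i + n * j) := by
  have hh0 : h ≠ 0 := ne_zero_of_natDegree_gt (n := 0) (by rw [hh]; positivity)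
  have hcomp (a : I[X]) : eval₂RingHom (C.comp κ) f a = (a.map κ).comp f := by
    rw [coe_eval₂RingHom, comp, eval₂_map]
  have hne {a : I[X]} (ha : a ≠ 0) : eval₂RingHom (C.comp κ) f a ≠ 0 := by
    rw [hcomp, Ne, comp_eq_zero_iff, not_or, not_and]
    refine ⟨by rwa [Polynomial.map_eq_zero_iff hκ], fun _ hc => ?_⟩
    rw [hc, natDegree_C] at hf
    exact (Nat.mul_pos hq hl).ne hf
  have hnd (a : I[X]) (j : ℕ) (ha : a ≠ 0) :
      (eval₂RingHom (C.comp κ) f a * h ^ j).natDegree = l * (q * a.natDegree + n * j) := by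
    rw [natDegree_mul (hne ha) (pow_ne_zero _ hh0), natDegree_pow, hh, hcomp, natDegree_comp,
      natDegree_map_eq_of_injective hκ, hf]
    ring
  rw [eval₂_eq_sum_range' _ hdeg]
  set t : ℕ → G[X] := fun j => eval₂RingHom (C.comp κ) f (g.coeff j) * h ^ j with ht
  have hcoef {j : ℕ} (h0 : t j ≠ 0) : g.coeff j ≠ 0 := by
    intro hc; simp [ht, hc] at h0
  have hsum : degree (∑ j ∈ Finset.range q, t j) = (Finset.range q).sup fun j => degree (t j) := by
    apply degree_sum_eq_of_disjoint
    rintro j ⟨hj, hj0⟩ j' ⟨hj', hj'0⟩ hjj' heq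
    simp only [Function.comp] at heq
    have heq := natDegree_eq_of_degree_eq heq
    rw [hnd _ _ (hcoef hj0), hnd _ _ (hcoef hj'0)] at heq
    have heq := Nat.eq_of_mul_eq_mul_left hl heq
    have hmod : n * j ≡ n * j' [MOD q] := by
      have := congrArg (· % q) heq
      simpa [Nat.ModEq, Nat.add_mod] using this
    have := Nat.ModEq.cancel_left_of_coprime hqn hmod
    rw [Nat.ModEq, Nat.mod_eq_of_lt (Finset.mem_range.1 hj),
      Nat.mod_eq_of_lt (Finset.mem_range.1 hj')] at this
    exact hjj' this
  obtain ⟨j, hj, hjs⟩ := Finset.exists_mem_eq_sup (Finset.range q) ⟨0, Finset.mem_range.2 hq⟩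
    fun j => degree (t j)
  rw [hjs] at hsum
  have hlead : t g.natDegree ≠ 0 :=
    mul_ne_zero (hne (by simpa using hg)) (pow_ne_zero _ hh0)
  have htj : t j ≠ 0 := by
    intro h0
    have := Finset.le_sup (f := fun j => degree (t j)) (Finset.mem_range.2 hdeg)
    rw [hjs, h0, degree_zero, le_bot_iff, degree_eq_bot] at this
    exact hlead this
  refine ⟨?_, (g.coeff j).natDegree, j, ?_⟩
  · rw [← degree_ne_bot, hsum]
    exact degree_ne_bot.2 htj
  · rw [natDegree_eq_of_degree_eq hsum, hnd _ _ (hcoef htj)]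

/-! ### The hypersurface ring and its localization at `x` -/

namespace HypersurfaceRing

variable (k : Type*) [Field k] (m s n : ℕ)

/-- The image of `X`. -/
noncomputable def x : HypersurfaceRing k m s n :=
  Ideal.Quotient.mk (Ideal.span {hypersurfacePoly k m s n}) (MvPolynomial.X 0)

/-- The image of `Z`. -/
noncomputable def z : HypersurfaceRing k m s n :=
  Ideal.Quotient.mk (Ideal.span {hypersurfacePoly k m s n}) (MvPolynomial.X 2)

/-- The image of `T`. -/
noncomputable def t : HypersurfaceRing k m s n :=
  Ideal.Quotient.mk (Ideal.span {hypersurfacePoly k m s n}) (MvPolynomial.X 3)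

theorem relation : x k m s n ^ m * y k m s n + t k m s n ^ s + z k m s n ^ n = 0 := by
  have h : Ideal.Quotient.mk (Ideal.span {hypersurfacePoly k m s n}) (hypersurfacePoly k m s n)
      = 0 := Ideal.Quotient.eq_zero_iff_mem.2 (Ideal.mem_span_singleton_self _)
  exact h

variable {k m s n}

theorem eq_top_of_mem {S : Subalgebra k (HypersurfaceRing k m s n)} (hx : x k m s n ∈ S)
    (hy : y k m s n ∈ S) (hz : z k m s n ∈ S) (ht : t k m s n ∈ S) : S = ⊤ := by
  refine eq_top_iff.2 fun b hb => ?_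
  clear hb
  obtain ⟨f, rfl⟩ := Ideal.Quotient.mk_surjective b
  induction f using MvPolynomial.induction_on with
  | C a => exact S.algebraMap_mem a
  | add f g hf hg => rw [map_add]; exact S.add_mem hf hg
  | mul_X f i hf =>
    rw [map_mul]
    refine S.mul_mem hf ?_
    fin_cases i
    exacts [hx, hy, hz, ht]

/-- The homomorphism determined by the images of the four generators. -/
noncomputable def lift {A : Type*} [CommRing A] [Algebra k A] (a b c d : A)
    (h : a ^ m * b + d ^ s + c ^ n = 0) : HypersurfaceRing k m s n →ₐ[k] A :=
  Ideal.Quotient.liftₐ _ (MvPolynomial.aeval ![a, b, c, d]) fun f hf => by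
    obtain ⟨g, rfl⟩ := Ideal.mem_span_singleton.1 hf
    simp [hypersurfacePoly, h]

section lift

variable {A : Type*} [CommRing A] [Algebra k A] {a b c d : A}
    (h : a ^ m * b + d ^ s + c ^ n = 0)

@[simp]
theorem lift_x : lift a b c d h (x k m s n) = a :=
  (MvPolynomial.aeval_X ![a, b, c, d] 0)

@[simp]
theorem lift_y : lift a b c d h (y k m s n) = b :=
  (MvPolynomial.aeval_X ![a, b, c, d] 1)

@[simp]
theorem lift_z : lift a b c d h (z k m s n) = c :=
  (MvPolynomial.aeval_X ![a, b, c, d] 2)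

@[simp]
theorem lift_t : lift a b c d h (t k m s n) = d :=
  (MvPolynomial.aeval_X ![a, b, c, d] 3)

end lift

variable (k m s n) in
/-- The homomorphism from `k[X, Z, T]`. -/
noncomputable def baseHom : MvPolynomial (Fin 3) k →ₐ[k] HypersurfaceRing k m s n :=
  MvPolynomial.aeval ![x k m s n, z k m s n, t k m s n]

theorem baseHom_X_zero : baseHom k m s n (.X 0) = x k m s n := by simp [baseHom]

theorem baseHom_X_one : baseHom k m s n (.X 1) = z k m s n := by simp [baseHom]

theorem baseHom_X_two : baseHom k m s n (.X 2) = t k m s n := by simp [baseHom]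

theorem exists_x_pow_mul_eq (b : HypersurfaceRing k m s n) :
    ∃ j f, x k m s n ^ j * b = baseHom k m s n f := by
  have hb {j f} (b : HypersurfaceRing k m s n) (h : x k m s n ^ j * b = baseHom k m s n f)
      (i : ℕ) : x k m s n ^ (i + j) * b = baseHom k m s n (.X 0 ^ i * f) := by
    rw [map_mul, map_pow, baseHom_X_zero, ← h]; ring
  let S : Subalgebra k (HypersurfaceRing k m s n) :=
    { carrier := {b | ∃ j f, x k m s n ^ j * b = baseHom k m s n f}
      mul_mem' := by
        rintro b c ⟨i, f, hf⟩ ⟨j, g, hg⟩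
        exact ⟨i + j, f * g, by rw [map_mul, ← hf, ← hg]; ring⟩
      add_mem' := by
        rintro b c ⟨i, f, hf⟩ ⟨j, g, hg⟩
        refine ⟨i + j, .X 0 ^ j * f + .X 0 ^ i * g, ?_⟩
        rw [map_add, ← hb _ hf, ← hb _ hg, mul_add, add_comm i j]
      algebraMap_mem' := fun c => ⟨0, algebraMap _ _ c, by rw [AlgHom.commutes]; ring⟩ }
  have : S = ⊤ := by
    apply eq_top_of_mem
    · exact ⟨0, .X 0, by rw [baseHom_X_zero]; ring⟩
    · refine ⟨m, -(.X 2 ^ s + .X 1 ^ n), ?_⟩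
      rw [map_neg, map_add, map_pow, map_pow, baseHom_X_one, baseHom_X_two]
      linear_combination relation k m s n
    · exact ⟨0, .X 1, by rw [baseHom_X_one]; ring⟩
    · exact ⟨0, .X 2, by rw [baseHom_X_two]; ring⟩
  have hbS : b ∈ S := this ▸ Algebra.mem_top
  exact hbS

theorem eq_zero_of_x_mul_eq_zero (hm : m ≠ 0) (hn : n ≠ 0) {b : HypersurfaceRing k m s n}
    (h : x k m s n * b = 0) : b = 0 := by
  obtain ⟨f, rfl⟩ := Ideal.Quotient.mk_surjective b
  rw [x, ← map_mul, Ideal.Quotient.eq_zero_iff_mem, Ideal.mem_span_singleton] at h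
  rw [Ideal.Quotient.eq_zero_iff_mem, Ideal.mem_span_singleton]
  obtain ⟨g, hg⟩ := h
  have hX : Prime (MvPolynomial.X 0 : MvPolynomial (Fin 4) k) := MvPolynomial.X_prime
  rcases hX.dvd_or_dvd (hg ▸ dvd_mul_right _ _) with h1 | ⟨c, rfl⟩
  -- At the point `(0, 0, 0, 1)` the variable `X` vanishes while the defining polynomial takes the
  -- value `1`.
  · have h2 := map_dvd (MvPolynomial.aeval (R := k) (![0, 0, 0, 1] : Fin 4 → k)) h1
    simp [hypersurfacePoly, hm, hn] at h2
  · exact ⟨c, mul_left_cancel₀ hX.ne_zero (by rw [hg]; ring)⟩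

theorem eq_zero_of_x_pow_mul_eq_zero (hm : m ≠ 0) (hn : n ≠ 0) {b : HypersurfaceRing k m s n}
    (j : ℕ) (h : x k m s n ^ j * b = 0) : b = 0 := by
  induction j with
  | zero => simpa using h
  | succ j ih =>
    refine ih (eq_zero_of_x_mul_eq_zero hm hn ?_)
    rw [← h]; ring

/-- The relation can be solved for `y` once `x` is inverted, and injectivity holds because `x` is
not a zero divisor. -/
theorem exists_injective (hm : m ≠ 0) (hn : n ≠ 0) :
    ∃ ψ : HypersurfaceRing k m s n →ₐ[k] FractionRing (MvPolynomial (Fin 3) k),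
      Function.Injective ψ ∧ ∀ f, ψ (baseHom k m s n f) = algebraMap _ _ f := by
  let K := FractionRing (MvPolynomial (Fin 3) k)
  let α : MvPolynomial (Fin 3) k →ₐ[k] K := Algebra.algHom k _ K
  have hα : Function.Injective α := IsFractionRing.injective (MvPolynomial (Fin 3) k) K
  have hX : α (.X 0) ≠ 0 := by
    rw [Ne, map_eq_zero_iff α hα]; exact MvPolynomial.X_ne_zero 0
  let ψ : HypersurfaceRing k m s n →ₐ[k] K :=
    lift (α (.X 0)) (-(α (.X 2) ^ s + α (.X 1) ^ n) / α (.X 0) ^ m) (α (.X 1)) (α (.X 2)) (by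
      rw [mul_div_cancel₀ _ (pow_ne_zero _ hX)]; ring)
  have hψ : ψ.comp (baseHom k m s n) = α := by
    ext i
    rw [AlgHom.comp_apply]
    fin_cases i
    · exact (congrArg ψ baseHom_X_zero).trans (lift_x _)
    · exact (congrArg ψ baseHom_X_one).trans (lift_z _)
    · exact (congrArg ψ baseHom_X_two).trans (lift_t _)
  refine ⟨ψ, (injective_iff_map_eq_zero ψ).2 fun b hb => ?_, fun f => congrArg (· f) hψ⟩
  obtain ⟨j, f, hf⟩ := exists_x_pow_mul_eq b
  have h1 : α f = 0 := by
    rw [← hψ, AlgHom.comp_apply, ← hf, map_mul, hb, mul_zero]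
  rw [(map_eq_zero_iff α hα).1 h1, map_zero] at hf
  exact eq_zero_of_x_pow_mul_eq_zero hm hn j hf

theorem isDomain (hm : m ≠ 0) (hn : n ≠ 0) : IsDomain (HypersurfaceRing k m s n) := by
  obtain ⟨ψ, hψ, -⟩ := exists_injective (k := k) (s := s) hm hn
  exact Function.Injective.isDomain ψ hψ

theorem baseHom_injective (hm : m ≠ 0) (hn : n ≠ 0) :
    Function.Injective (baseHom k m s n) := by
  obtain ⟨ψ, -, hψ⟩ := exists_injective (k := k) (s := s) hm hn
  refine Function.Injective.of_comp (f := ψ) ?_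
  rw [show ψ ∘ baseHom k m s n = algebraMap _ _ from funext hψ]
  exact IsFractionRing.injective _ _

end HypersurfaceRing

/-! ### Multiplicities in a factorial localization -/

theorem Prime.mul_multiplicity_add_eq {D : Type*} [CommRing D] [IsDomain D]
    [UniqueFactorizationMonoid D] {π f g c d : D} (hπ : Prime π) {a b : ℕ} (hf : f ≠ 0)
    (hg : g ≠ 0) (hc : c ≠ 0) (hd : d ≠ 0) (h : f ^ a * c = g ^ b * d) :
    a * multiplicity π f + multiplicity π c = b * multiplicity π g + multiplicity π d := by
  have key {f c : D} (hf : f ≠ 0) (hc : c ≠ 0) (a : ℕ) :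
      multiplicity π (f ^ a * c) = a * multiplicity π f + multiplicity π c := by
    rw [multiplicity_mul hπ (.of_prime_left hπ (mul_ne_zero (pow_ne_zero _ hf) hc)),
      (FiniteMultiplicity.of_prime_left hπ hf).multiplicity_pow hπ]
  rw [← key hf hc, ← key hg hd, h]

/-- A prime ideal `(a, b)` with `a ^ m * y = -b ^ N` cannot become principal after inverting an
element outside of it, if the result is a localization of a unique factorization domain. -/
theorem Ideal.IsPrime.mem_of_eq_span_pair {D E : Type*} [CommRing D] [IsDomain D]
    [UniqueFactorizationMonoid D] [CommRing E] [IsDomain E] {ι : D →+* E}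
    (hι : Function.Injective ι) {ξ : D} (hloc : ∀ b, ∃ j f, ι ξ ^ j * b = ι f)
    {Q : Ideal E} (hQ : Q.IsPrime) {a b y : E} (hab : Q = Ideal.span {a, b}) (ha : a ≠ 0)
    {m N : ℕ} (hm : 1 < m) (hN : 1 < N) (hmN : m.Coprime N) (hrel : a ^ m * y = -b ^ N)
    (hy : y ∉ Q) : ι ξ ∈ Q := by
  by_contra hξ
  have hloc₂ (b c : E) : ∃ j f g, ι ξ ^ j * b = ι f ∧ ι ξ ^ j * c = ι g := by
    obtain ⟨i, f, hf⟩ := hloc b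
    obtain ⟨j, g, hg⟩ := hloc c
    refine ⟨i + j, ξ ^ j * f, ξ ^ i * g, ?_, ?_⟩
    · rw [map_mul, map_pow, ← hf]; ring
    · rw [map_mul, map_pow, ← hg]; ring
  have hξ0 : ι ξ ≠ 0 := fun h => hξ (h ▸ Q.zero_mem)
  have hy0 : y ≠ 0 := fun h => hy (h ▸ Q.zero_mem)
  have hb : b ≠ 0 := by
    rintro rfl
    rw [zero_pow (by omega), neg_zero] at hrel
    exact mul_ne_zero (pow_ne_zero _ ha) hy0 hrel
  have haQ : a ∈ Q := hab ▸ Ideal.subset_span (by simp)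
  obtain ⟨i, f, g, hf, hg⟩ := hloc₂ a b
  obtain ⟨c, y', hy'⟩ := hloc y
  have hne {e : E} {d : D} {l : ℕ} (he : e ≠ 0) (h : ι ξ ^ l * e = ι d) : d ≠ 0 := by
    rintro rfl
    rw [map_zero] at h
    exact mul_ne_zero (pow_ne_zero _ hξ0) he h
  have hf0 := hne ha hf
  have hg0 := hne hb hg
  have hy'0 := hne hy0 hy'
  have hξ'0 : ξ ≠ 0 := by rintro rfl; simp at hξ0
  have hQ' : (Q.comap ι).IsPrime := hQ.comap ι
  -- The prime ideal `Q` contains `a`, hence the numerator `f` of `a`, hence a prime factor of `f`.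
  obtain ⟨π, hπ, hπQ, hπf⟩ : ∃ π, Prime π ∧ ι π ∈ Q ∧ π ∣ f := by
    obtain ⟨S, hS, u, hu⟩ := UniqueFactorizationMonoid.exists_prime_factors f hf0
    have h1 : S.prod * u ∈ Q.comap ι := by
      rw [hu, Ideal.mem_comap, ← hf]; exact Q.mul_mem_left _ haQ
    rw [Ideal.mul_unit_mem_iff_mem _ u.isUnit, hQ'.multiset_prod_mem_iff_exists_mem] at h1
    obtain ⟨π, hπS, hπ⟩ := h1
    exact ⟨π, hS π hπS, hπ, (Multiset.dvd_prod hπS).trans (hu ▸ dvd_mul_right _ _)⟩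
  have hdvd {d : D} (h : π ∣ d) : ι d ∈ Q := Ideal.mem_of_dvd _ (map_dvd ι h) hπQ
  have hπξ : ¬ π ∣ ξ := fun h => hξ (hdvd h)
  have hπξ' (l : ℕ) : ¬ π ∣ ξ ^ l := fun h => hπξ (hπ.dvd_of_dvd_pow h)
  have hπy : ¬ π ∣ y' := by
    intro h
    have h1 := hdvd h
    rw [← hy'] at h1
    rcases hQ.mem_or_mem h1 with h1 | h1
    · exact hξ (hQ.mem_of_pow_mem _ h1)
    · exact hy h1
  have hrel' : f ^ m * (y' * ξ ^ (i * N)) = g ^ N * -ξ ^ (i * m + c) := by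
    apply hι
    simp only [map_mul, map_pow, map_neg, ← hf, ← hg, ← hy']
    linear_combination (ι ξ ^ (i * m) * ι ξ ^ (i * N) * ι ξ ^ c) * hrel
  have hmult := hπ.mul_multiplicity_add_eq hf0 hg0 (mul_ne_zero hy'0 (pow_ne_zero _ hξ'0))
    (neg_ne_zero.2 (pow_ne_zero _ hξ'0)) hrel'
  rw [multiplicity_eq_zero.2 (fun h => (hπ.dvd_or_dvd h).elim hπy (hπξ' _)),
    multiplicity_eq_zero.2 (fun h => hπξ' _ ((dvd_neg).1 h)), add_zero, add_zero] at hmult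
  have hvf : multiplicity π f ≠ 0 := fun h => multiplicity_eq_zero.1 h hπf
  have hvg : multiplicity π g ≠ 0 := by
    intro h
    rw [h, mul_zero, mul_eq_zero] at hmult
    omega
  -- From `m v(f) = N v(g)` with `m`, `N` coprime, `N ∣ v(f)` and `m ∣ v(g)`; both valuations are
  -- nonzero, so both are at least `2`.
  have hf2 : π ^ 2 ∣ f := pow_dvd_of_le_multiplicity <| hN.trans_le <|
    Nat.le_of_dvd (Nat.pos_of_ne_zero hvf) <|
      hmN.symm.dvd_of_dvd_mul_left (hmult ▸ dvd_mul_right _ _)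
  have hg2 : π ^ 2 ∣ g := pow_dvd_of_le_multiplicity <| hm.trans_le <|
    Nat.le_of_dvd (Nat.pos_of_ne_zero hvg) <|
      hmN.dvd_of_dvd_mul_left (hmult ▸ dvd_mul_right _ _)
  rw [hab, Ideal.mem_span_pair] at hπQ
  obtain ⟨α, β, hαβ⟩ := hπQ
  -- Up to a power of `ξ`, `π` is a combination of `f` and `g`, so `π^2` divides it; this forces `π
  -- ∣ ξ`.
  obtain ⟨M, α', β', hα, hβ⟩ := hloc₂ α β
  have h1 : ξ ^ (M + i) * π = α' * f + β' * g := by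
    apply hι
    simp only [map_mul, map_pow, map_add, ← hf, ← hg, ← hα, ← hβ, ← hαβ]
    ring
  have h2 : π * π ∣ ξ ^ (M + i) * π := by
    rw [h1, ← sq]
    exact dvd_add (hf2.mul_left _) (hg2.mul_left _)
  exact hπξ' _ ((mul_dvd_mul_iff_right hπ.ne_zero).1 h2)

/-! ### The cuspidal quotient by `(x, w)` -/

theorem Polynomial.exists_natDegree_lt_eval₂_eq {R S : Type*} [CommRing R] [CommRing S]
    (F : R →+* S) {b : S} {M : R[X]} (hM : M.Monic) (hM0 : 0 < M.natDegree)
    (hb : M.eval₂ F b = 0) (g : R[X]) :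
    ∃ g' : R[X], g'.natDegree < M.natDegree ∧ g'.eval₂ F b = g.eval₂ F b := by
  refine ⟨g %ₘ M, natDegree_modByMonic_lt _ hM ?_, ?_⟩
  · rintro rfl; simp at hM0
  · conv_rhs => rw [← modByMonic_add_div g M]
    rw [eval₂_add, eval₂_mul, hb, zero_mul, add_zero]

theorem Polynomial.hom_eval₂_eval₂ {R S S' : Type*} [CommRing R] [CommRing S] [CommRing S']
    (ψ : S →+* S') (κ : R →+* S) (a b : S) (g : R[X][X]) :
    ψ (g.eval₂ (eval₂RingHom κ a) b) = g.eval₂ (eval₂RingHom (ψ.comp κ) (ψ a)) (ψ b) := by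
  rw [hom_eval₂]
  congr 1
  ext <;> simp

namespace HypersurfaceRing

variable {k : Type*} [Field k] {p m r j q : ℕ} [CharP k p]

theorem charP {n s : ℕ} [Nontrivial (HypersurfaceRing k m s n)] :
    CharP (HypersurfaceRing k m s n) p :=
  charP_of_injective_algebraMap (algebraMap k _).injective p

variable [Fact p.Prime]

theorem relation_pow [Nontrivial (HypersurfaceRing k m (p ^ r * q) (p ^ (r + j)))] :
    x k m (p ^ r * q) (p ^ (r + j)) ^ m * y k m (p ^ r * q) (p ^ (r + j)) =
      -(t k m (p ^ r * q) (p ^ (r + j)) ^ q + z k m (p ^ r * q) (p ^ (r + j)) ^ p ^ j) ^ p ^ r := by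
  have : CharP (HypersurfaceRing k m (p ^ r * q) (p ^ (r + j))) p := charP
  rw [add_pow_char_pow, ← pow_mul, ← pow_mul, mul_comm q, ← pow_add, add_comm j]
  linear_combination relation k m (p ^ r * q) (p ^ (r + j))

variable (k p m r j q) in
/-- The parametrization of the locus `x = 0` by `k[Y][τ]`: `Z ↦ -τ ^ q`, `T ↦ τ ^ p ^ j`. -/
noncomputable def cuspHom (hm : m ≠ 0) :
    HypersurfaceRing k m (p ^ r * q) (p ^ (r + j)) →ₐ[k] k[X][X] :=
  lift 0 (C X) (-X ^ q) (X ^ p ^ j) (by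
    have : CharP k[X][X] p := inferInstance
    -- A `p`-power of `-1` is `-1` in characteristic `p`, even for `p = 2`.
    rw [zero_pow hm, zero_mul, zero_add, neg_pow (X ^ q : k[X][X]), neg_one_pow_char_pow, ← pow_mul,
      ← pow_mul, pow_add]
    ring)

theorem span_le_ker_cuspHom (hm : m ≠ 0) :
    Ideal.span {x k m (p ^ r * q) (p ^ (r + j)),
      t k m (p ^ r * q) (p ^ (r + j)) ^ q + z k m (p ^ r * q) (p ^ (r + j)) ^ p ^ j} ≤
    RingHom.ker (cuspHom k p m r j q hm) := by
  rw [Ideal.span_le, Set.insert_subset_iff, Set.singleton_subset_iff]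
  constructor
  · simp [RingHom.mem_ker, cuspHom]
  · simp only [SetLike.mem_coe, RingHom.mem_ker, cuspHom, map_add, map_pow, lift_t, lift_z]
    rw [neg_pow (X ^ q : k[X][X]), neg_one_pow_char_pow, ← pow_mul, ← pow_mul]
    ring

/-- Where `x` and `w` vanish, each element is a polynomial in `t` of degree less than `q` over
`k[y][z]`. By the semigroup degree lemma, a nonzero such remainder stays nonzero on the cusp. -/
theorem map_eq_zero_of_cuspHom_eq_zero (hm : m ≠ 0) (hpq : ¬ p ∣ q) {R : Type*} [CommRing R]
    [Algebra k R] (π : HypersurfaceRing k m (p ^ r * q) (p ^ (r + j)) →ₐ[k] R) (ρ : R →+* k[X][X])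
    (hρπ : ∀ c, ρ (π c) = cuspHom k p m r j q hm c) (hx : π (x _ _ _ _) = 0)
    (hw : π (t _ _ _ _) ^ q + π (z _ _ _ _) ^ p ^ j = 0)
    {b : HypersurfaceRing k m (p ^ r * q) (p ^ (r + j))}
    (hb : cuspHom k p m r j q hm b = 0) : π b = 0 := by
  have hp : p.Prime := Fact.out
  have hq : q ≠ 0 := by rintro rfl; simp at hpq
  let κ : k[X] →ₐ[k] R := aeval (π (y _ _ _ _))
  let E : k[X][X][X] →+* R :=
    eval₂RingHom (eval₂RingHom (κ : k[X] →+* R) (π (z _ _ _ _))) (π (t _ _ _ _))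
  have hEC (f) : E (C (C f)) = κ f := by simp [E]
  have hsurj : π b ∈ (RingHom.range (R := k[X][X][X]) E) := by
    let S : Subalgebra k R :=
      { (RingHom.range (R := k[X][X][X]) E) with
        algebraMap_mem' := fun c => ⟨C (C (C c)), by
          rw [hEC]; exact κ.commutes c⟩ }
    have : S.comap π = ⊤ := by
      apply eq_top_of_mem
      · exact ⟨0, by rw [map_zero]; exact hx.symm⟩
      · exact ⟨C (C X), by rw [hEC]; exact aeval_X _⟩
      · exact ⟨C X, by simp [E]⟩
      · exact ⟨X, by simp [E]⟩
    have hbS : b ∈ S.comap π := this ▸ Algebra.mem_top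
    exact hbS
  obtain ⟨g, hg⟩ := hsurj
  have hM : (X ^ q + C (X ^ p ^ j) : k[X][X][X]).Monic := monic_X_pow_add_C _ hq
  have hMd : (X ^ q + C (X ^ p ^ j) : k[X][X][X]).natDegree = q := natDegree_X_pow_add_C
  obtain ⟨g', hg'd, hg'⟩ := exists_natDegree_lt_eval₂_eq
    (eval₂RingHom (κ : k[X] →+* R) (π (z _ _ _ _))) (b := π (t _ _ _ _)) hM (by omega) (by
      simpa only [eval₂_add, eval₂_X_pow, eval₂_C, coe_eval₂RingHom] using hw) g
  rw [hMd] at hg'd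
  have hzero : g'.eval₂ (eval₂RingHom (C.comp (RingHom.id k[X])) (-X ^ q)) (X ^ p ^ j)
      = (0 : k[X][X]) := by
    have h1 := congrArg ρ (hg'.trans hg)
    rw [hρπ, hb, hom_eval₂_eval₂, hρπ, hρπ] at h1
    have h2 : ρ.comp (κ : k[X] →+* R) = C.comp (RingHom.id k[X]) := by
      ext c
      · have : ρ (κ (C c)) = cuspHom k p m r j q hm (algebraMap k _ c) := by
          rw [← hρπ, AlgHom.commutes]; exact congrArg ρ (κ.commutes c)
        simp only [RingHom.comp_apply, RingHom.coe_coe, this, AlgHom.commutes]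
        rfl
      · have : ρ (κ X) = cuspHom k p m r j q hm (y _ _ _ _) := by
          rw [← hρπ]; exact congrArg ρ (aeval_X _)
        simp [this, cuspHom]
    rw [h2] at h1
    simpa only [cuspHom, lift_z, lift_t] using h1
  have hcop : q.Coprime (p ^ j) := ((Nat.Prime.coprime_iff_not_dvd hp).2 hpq).symm.pow_right j
  have hg0 : g' = 0 := by
    by_contra h0
    exact (exists_natDegree_eval₂_eval₂ (κ := RingHom.id k[X]) Function.injective_id
      (Nat.pos_of_ne_zero hq) (pow_pos hp.pos j) one_pos hcop (f := -X ^ q) (h := X ^ p ^ j)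
      (by simp) (by simp) h0 hg'd).1 hzero
  rw [← hg]
  refine hg'.symm.trans ?_
  rw [hg0, eval₂_zero]

theorem ker_cuspHom_le (hm : m ≠ 0) (hpq : ¬ p ∣ q)
    (J : Ideal (HypersurfaceRing k m (p ^ r * q) (p ^ (r + j))))
    (hJ : J ≤ RingHom.ker (cuspHom k p m r j q hm)) (hx : x _ _ _ _ ∈ J)
    (hw : t _ _ _ _ ^ q + z _ _ _ _ ^ p ^ j ∈ J) :
    RingHom.ker (cuspHom k p m r j q hm) ≤ J := fun b hb => by
  let ρ : _ ⧸ J →+* k[X][X] :=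
    Ideal.Quotient.lift J (cuspHom k p m r j q hm).toRingHom fun a ha => hJ ha
  have hρ (c) : ρ (Ideal.Quotient.mkₐ k J c) = cuspHom k p m r j q hm c :=
    Ideal.Quotient.lift_mk _ _ _
  have hx' : Ideal.Quotient.mkₐ k J (x _ _ _ _) = 0 := Ideal.Quotient.eq_zero_iff_mem.2 hx
  have hw' : Ideal.Quotient.mkₐ k J (t _ _ _ _) ^ q +
      Ideal.Quotient.mkₐ k J (z _ _ _ _) ^ p ^ j = 0 := by
    rw [← map_pow, ← map_pow, ← map_add]
    exact Ideal.Quotient.eq_zero_iff_mem.2 hw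
  have hb' : Ideal.Quotient.mkₐ k J b = 0 :=
    map_eq_zero_of_cuspHom_eq_zero (R := HypersurfaceRing k m (p ^ r * q) (p ^ (r + j)) ⧸ J) hm hpq
      (π := Ideal.Quotient.mkₐ k J) ρ hρ hx' hw' hb
  exact Ideal.Quotient.eq_zero_iff_mem.1 hb'

theorem ker_cuspHom (hm : m ≠ 0) (hpq : ¬ p ∣ q) :
    RingHom.ker (cuspHom k p m r j q hm) = Ideal.span {x k m (p ^ r * q) (p ^ (r + j)),
      t k m (p ^ r * q) (p ^ (r + j)) ^ q + z k m (p ^ r * q) (p ^ (r + j)) ^ p ^ j} :=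
  le_antisymm (ker_cuspHom_le hm hpq _ (span_le_ker_cuspHom hm)
    (Ideal.subset_span (Set.mem_insert _ _)) (Ideal.subset_span (Set.mem_insert_of_mem _ rfl)))
    (span_le_ker_cuspHom hm)

end HypersurfaceRing

/-! ### Invariance of `x`, and triviality once `w` is invariant -/

namespace IsExponentialMap

variable {k B : Type*} [CommRing k] [CommRing B] [IsDomain B] [Algebra k B] {φ : B →ₐ[k] B[X]}
  {p : ℕ} [Fact p.Prime]

/-- If `x ^ m * y = -w ^ p ^ r` with `y` invariant and `(x, w)` is the kernel of a homomorphism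
under which `y` becomes prime, then `(x, w)` is stable under the exponential map. -/
theorem map_mem_ker_of_pow_mul_eq (hφ : IsExponentialMap φ) {x y w : B} {m r : ℕ} (hm : 1 < m)
    (hr : 1 ≤ r) (hx : x ≠ 0) (hrel : x ^ m * y = -w ^ p ^ r) (hy : y ∈ expInvariants φ)
    {S : Type*} [CommRing S] [IsDomain S] [UniqueFactorizationMonoid S] {ρ : B →+* S}
    (hker : RingHom.ker ρ = Ideal.span {x, w}) (hρy : Prime (ρ y)) {D : Type*} [CommRing D]
    [IsDomain D] [UniqueFactorizationMonoid D] {ι : D →+* B} (hι : Function.Injective ι) {ξ : D}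
    (hξ : ι ξ = x) (hloc : ∀ b, ∃ j f, x ^ j * b = ι f) :
    φ x ∈ RingHom.ker (mapRingHom ρ) := by
  have hp : p.Prime := Fact.out
  have hrel' : φ x ^ m * C y = -φ w ^ p ^ r := by
    rw [← mem_expInvariants.1 hy, ← map_pow, ← map_mul, hrel, map_neg, map_pow]
  by_cases hpm : p ∣ m
  -- If `φ x` is nonzero modulo `(x, w)`, the multiplicities of `ρ y` in the reduced relation
  -- satisfy `m v + 1 = p^r v'`, impossible when `p` divides `m`.
  · by_contra hF
    rw [RingHom.mem_ker, coe_mapRingHom] at hF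
    have h1 : (φ x).map ρ ^ m * C (ρ y) = (φ w).map ρ ^ p ^ r * (-1) := by
      rw [← map_C ρ, ← Polynomial.map_pow, ← Polynomial.map_mul, hrel', Polynomial.map_neg,
        Polynomial.map_pow, mul_neg_one]
    have hπ : Prime (C (ρ y)) := prime_C_iff.2 hρy
    have hG : (φ w).map ρ ≠ 0 := by
      intro h0
      rw [h0, zero_pow (pow_ne_zero _ hp.ne_zero), zero_mul] at h1
      exact mul_ne_zero (pow_ne_zero _ hF) hπ.ne_zero h1
    have h2 := hπ.mul_multiplicity_add_eq hF hG hπ.ne_zero (neg_ne_zero.2 one_ne_zero) h1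
    rw [multiplicity_eq_zero.2 (fun h => hπ.not_isUnit (isUnit_of_dvd_unit h isUnit_one.neg)),
      multiplicity_self] at h2
    have h3 : p ∣ m * multiplicity (C (ρ y)) ((φ x).map ρ) + 1 := by
      rw [h2, add_zero]
      exact (dvd_pow_self p (by omega)).mul_right _
    exact hp.one_lt.ne' (Nat.dvd_one.1 ((Nat.dvd_add_right (hpm.mul_right _)).1 h3))
  -- The reflection carries the prime `(x, w)B[U]` to `(φ x, φ w)`, where the factoriality argument
  -- applies; `C x` lies in the latter exactly when `φ x` lies in the former.
  · set P := RingHom.ker (mapRingHom ρ) with hP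
    have hPprime : P.IsPrime := RingHom.ker_isPrime _
    have hPspan : P = Ideal.span {C x, C w} := by
      rw [hP, ker_mapRingHom, hker, Ideal.map_span, Set.image_pair]
    have hQspan : P.comap (reflection φ) = Ideal.span {φ x, φ w} := by
      refine le_antisymm (fun b hb => ?_) ?_
      · rw [Ideal.mem_comap, hPspan, Ideal.mem_span_pair] at hb
        obtain ⟨α, β, hαβ⟩ := hb
        refine Ideal.mem_span_pair.2 ⟨reflection φ α, reflection φ β, ?_⟩
        rw [← hφ.reflection_reflection b, ← hαβ, map_add, map_mul, map_mul, reflection_C,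
          reflection_C]
      · rw [Ideal.span_le, Set.insert_subset_iff, Set.singleton_subset_iff]
        simp only [SetLike.mem_coe, Ideal.mem_comap, hφ.reflection_apply_map]
        rw [hPspan]
        exact ⟨Ideal.subset_span (by simp), Ideal.subset_span (by simp)⟩
    have hlocX (f : B[X]) : ∃ j g, mapRingHom ι (C ξ) ^ j * f = mapRingHom ι g := by
      have hC : mapRingHom ι (C ξ) = C x := by simp [hξ]
      rw [hC]
      induction f using Polynomial.induction_on' with
      | add f g hf hg =>
        obtain ⟨i, f', hf⟩ := hf
        obtain ⟨j, g', hg⟩ := hg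
        refine ⟨i + j, C ξ ^ j * f' + C ξ ^ i * g', ?_⟩
        rw [map_add, map_mul, map_mul, map_pow, map_pow, hC, ← hf, ← hg]
        ring
      | monomial n b =>
        obtain ⟨j, d, hd⟩ := hloc b
        refine ⟨j, monomial n d, ?_⟩
        rw [coe_mapRingHom, map_monomial, ← hd, ← C_pow, C_mul_monomial]
    have hyQ : C y ∉ P.comap (reflection φ) := by
      rw [Ideal.mem_comap, reflection_C, mem_expInvariants.1 hy, hP, RingHom.mem_ker,
        coe_mapRingHom, map_C, C_eq_zero]
      exact hρy.ne_zero
    have h1 := Ideal.IsPrime.mem_of_eq_span_pair (ι := mapRingHom ι) (map_injective ι hι) hlocX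
      (hPprime.comap (reflection φ)) hQspan ((map_ne_zero_iff φ hφ.injective).2 hx) hm
      (Nat.one_lt_pow (by omega) hp.one_lt)
      (((Nat.Prime.coprime_iff_not_dvd hp).2 hpm).symm.pow_right r) hrel' hyQ
    simpa [hξ] using h1

/-- Frobenius puts `φ(x)^(p^r)` in `(x^(p^r), w^(p^r))`, and `w^(p^r) = -x^m y`, so `x` divides it.
The reflection swaps `x` and `φ x`, so `φ x` divides a nonzero constant and has degree `0`. -/
theorem mem_expInvariants_of_pow_mul_eq [CharP B p] (hφ : IsExponentialMap φ) {x y w : B}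
    {m r : ℕ} (hm : 1 < m) (hx : x ≠ 0) (hrel : x ^ m * y = -w ^ p ^ r)
    (hmem : φ x ∈ Ideal.span {C x, C w}) : x ∈ expInvariants φ := by
  have hp : p.Prime := Fact.out
  obtain ⟨α, β, hαβ⟩ := Ideal.mem_span_pair.1 hmem
  have hrel' : w ^ p ^ r = -(x ^ m * y) := by rw [hrel, neg_neg]
  obtain ⟨h, hh⟩ : C x ∣ φ x ^ p ^ r := by
    rw [← hαβ, add_pow_char_pow, mul_pow, mul_pow, ← C_pow (a := w), hrel', C_neg, C_mul,
      C_pow]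
    exact dvd_add ((dvd_pow_self _ (pow_ne_zero _ hp.ne_zero)).mul_left _)
      (((dvd_pow_self _ (by omega)).mul_right _).neg_right.mul_left _)
  have h1 := congrArg (reflection φ) hh
  rw [map_pow, hφ.reflection_apply_map, map_mul, reflection_C, ← C_pow] at h1
  apply hφ.mem_expInvariants_of_natDegree_eq_zero
  have h2 := natDegree_le_of_dvd (Dvd.intro _ h1.symm) (C_ne_zero.2 (pow_ne_zero _ hx))
  simpa using h2

/-- An exponential map fixing `t ^ q + z ^ p ^ j` is trivial if its invariants together with `z`
and `t` generate the ring. -/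
theorem expInvariants_eq_top [CharP B p] (hφ : IsExponentialMap φ) {z t : B} {q j : ℕ}
    (hq : 1 < q) (hpq : ¬ p ∣ q) (hj : 1 ≤ j) (hw : t ^ q + z ^ p ^ j ∈ expInvariants φ)
    (hgen : ∀ S : Subalgebra k B, expInvariants φ ≤ S → z ∈ S → t ∈ S → S = ⊤) :
    expInvariants φ = ⊤ := by
  have hp : p.Prime := Fact.out
  set w := t ^ q + z ^ p ^ j with hw_def
  have hn : 1 < p ^ j := Nat.one_lt_pow (by omega) hp.one_lt
  have hcop : q.Coprime (p ^ j) := ((Nat.Prime.coprime_iff_not_dvd hp).2 hpq).symm.pow_right j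
  have hdeg : q * (φ t).natDegree = p ^ j * (φ z).natDegree := by
    have h1 : φ t ^ q = -(φ z ^ p ^ j - C w) := by
      rw [← mem_expInvariants.1 hw, hw_def, map_add, map_pow, map_pow]; ring
    rw [← natDegree_pow, h1, natDegree_neg, natDegree_sub_C, natDegree_pow]
  obtain ⟨l, hl⟩ : q ∣ (φ z).natDegree := hcop.dvd_of_dvd_mul_left (hdeg ▸ dvd_mul_right _ _)
  have hl' : (φ t).natDegree = p ^ j * l := by
    refine Nat.eq_of_mul_eq_mul_left (by omega : 0 < q) ?_
    rw [hdeg, hl]; ring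
  rcases Nat.eq_zero_or_pos l with rfl | hl0
  · exact hgen _ le_rfl (hφ.mem_expInvariants_of_natDegree_eq_zero (by simpa using hl))
      (hφ.mem_expInvariants_of_natDegree_eq_zero (by simpa using hl'))
  exfalso
  obtain ⟨a, u, hu, hlu⟩ := Nat.exists_eq_pow_mul_and_not_dvd hl0.ne' p hp.ne_one
  -- Since `p` does not divide `q u`, the `p`-part of `deg φ(z) = q l` is that of `l`.
  obtain ⟨b, hb⟩ := hφ.exists_natDegree_eq_pow (a := z) (i := a) (u := q * u)
    (fun h => (hp.dvd_mul.1 h).elim hpq hu) (by rw [hl, hlu]; ring)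
  let κ : expInvariants φ →+* B := (expInvariants φ).val
  let E : (expInvariants φ)[X][X] →+* B := eval₂RingHom (eval₂RingHom κ z) t
  have hEC (f) : E (C (C f)) = f := by simp [E, κ]
  have hsurj : b ∈ RingHom.range (R := (expInvariants φ)[X][X]) E := by
    let S : Subalgebra k B :=
      { RingHom.range (R := (expInvariants φ)[X][X]) E with
        algebraMap_mem' := fun c => ⟨C (C (algebraMap k _ c)), by rw [hEC]; rfl⟩ }
    have : S = ⊤ := hgen S (fun c hc => ⟨C (C ⟨c, hc⟩), hEC _⟩) ⟨C X, by simp [E]⟩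
      ⟨X, by simp [E]⟩
    have hbS : b ∈ S := this ▸ Algebra.mem_top
    exact hbS
  obtain ⟨g, hg⟩ := hsurj
  -- The relation `t^q + (z^(p^j) - w) = 0` is monic in `t` over the invariants and `z`, so `b` has
  -- a representative of `t`-degree less than `q`.
  let c : (expInvariants φ)[X] := X ^ p ^ j - C ⟨w, hw⟩
  have hMd : (X ^ q + C c).natDegree = q := natDegree_X_pow_add_C
  obtain ⟨g', hg'd, hg'⟩ := exists_natDegree_lt_eval₂_eq (eval₂RingHom κ z) (b := t)
    (monic_X_pow_add_C c (by omega : q ≠ 0)) (by omega) (by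
      simp only [c, eval₂_add, eval₂_sub, eval₂_X_pow, eval₂_C, coe_eval₂RingHom]
      simp only [κ, hw_def]
      exact (add_sub_assoc _ _ _).symm.trans (sub_self _)) g
  rw [hMd] at hg'd
  have hgb : g'.eval₂ (eval₂RingHom κ z) t = b := hg'.trans hg
  have hg0 : g' ≠ 0 := by
    rintro rfl
    rw [eval₂_zero] at hgb
    rw [← hgb, map_zero, natDegree_zero] at hb
    exact (pow_pos hp.pos a).ne hb
  have h1 := hom_eval₂_eval₂ (φ : B →+* B[X]) κ z t g'
  have hκ : (φ : B →+* B[X]).comp κ = C.comp κ := by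
    ext1 c
    exact mem_expInvariants.1 c.2
  rw [hgb, hκ] at h1
  obtain ⟨-, i, i', hi⟩ := exists_natDegree_eval₂_eval₂ (κ := κ) Subtype.val_injective
    (by omega : 0 < q) (by omega : 0 < p ^ j) hl0 hcop hl hl' hg0 hg'd
  have h2 : p ^ a = l * (q * i + p ^ j * i') := by
    rw [← hb, ← hi]
    exact congrArg natDegree h1
  -- As `p^a` divides `l`, the semigroup element must be `1`, so `q` or `p^j` would divide `1`.
  have h3 : l * (q * i + p ^ j * i') ∣ l * 1 := by
    rw [← h2, mul_one, hlu]; exact dvd_mul_right _ _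
  have h4 := Nat.dvd_one.1 ((Nat.mul_dvd_mul_iff_left hl0).1 h3)
  rcases Nat.add_eq_one_iff.1 h4 with ⟨-, h5⟩ | ⟨h5, -⟩
  · exact hn.ne' (Nat.dvd_one.1 (h5 ▸ dvd_mul_right _ _))
  · exact hq.ne' (Nat.dvd_one.1 (h5 ▸ dvd_mul_right _ _))

end IsExponentialMap

/-! ### Assembly -/

theorem HypersurfaceRing.expInvariants_eq_top {k : Type*} [Field k] {p m r j q : ℕ}
    [Fact p.Prime] [CharP k p] (hm : 1 < m) (hpq : ¬ p ∣ q) (hq : 1 < q) (hr : 1 ≤ r)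
    (hj : 1 ≤ j)
    {φ : HypersurfaceRing k m (p ^ r * q) (p ^ (r + j)) →ₐ[k]
      (HypersurfaceRing k m (p ^ r * q) (p ^ (r + j)))[X]} (hφ : IsExponentialMap φ)
    (hy : y k m (p ^ r * q) (p ^ (r + j)) ∈ expInvariants φ) : expInvariants φ = ⊤ := by
  have hp : p.Prime := Fact.out
  have hm0 : m ≠ 0 := by omega
  have hn0 : p ^ (r + j) ≠ 0 := pow_ne_zero _ hp.ne_zero
  have : IsDomain (HypersurfaceRing k m (p ^ r * q) (p ^ (r + j))) := isDomain hm0 hn0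
  have : CharP (HypersurfaceRing k m (p ^ r * q) (p ^ (r + j))) p := charP
  have hrel := relation_pow (k := k) (p := p) (m := m) (r := r) (j := j) (q := q)
  have hι := baseHom_injective (k := k) (s := p ^ r * q) hm0 hn0
  have hx0 : x k m (p ^ r * q) (p ^ (r + j)) ≠ 0 := by
    rw [← baseHom_X_zero]
    exact (map_ne_zero_iff _ hι).2 (MvPolynomial.X_ne_zero 0)
  have hker := ker_cuspHom (k := k) (r := r) (j := j) hm0 hpq
  have hρy : Prime (cuspHom k p m r j q hm0 (y _ _ _ _)) := by
    rw [cuspHom, lift_y]; exact prime_C_iff.2 prime_X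
  have hmem := hφ.map_mem_ker_of_pow_mul_eq hm hr hx0 hrel hy
    (ρ := (cuspHom k p m r j q hm0).toRingHom) hker hρy
    (ι := (baseHom k m (p ^ r * q) (p ^ (r + j))).toRingHom) hι baseHom_X_zero exists_x_pow_mul_eq
  rw [ker_mapRingHom] at hmem
  have hx : x k m (p ^ r * q) (p ^ (r + j)) ∈ expInvariants φ := by
    refine hφ.mem_expInvariants_of_pow_mul_eq hm hx0 hrel ?_
    rw [← Set.image_pair, ← Ideal.map_span, ← hker]
    exact hmem
  have hw : t k m (p ^ r * q) (p ^ (r + j)) ^ q + z k m (p ^ r * q) (p ^ (r + j)) ^ p ^ j ∈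
      expInvariants φ := by
    -- Since `w^(p^r) = -x^m y` is invariant, `p^r deg φ(w) = 0`.
    apply hφ.mem_expInvariants_of_natDegree_eq_zero
    have h1 := (expInvariants φ).neg_mem ((expInvariants φ).mul_mem (pow_mem hx m) hy)
    rw [hrel, neg_neg, IsExponentialMap.mem_expInvariants, map_pow] at h1
    have h2 := congrArg natDegree h1
    rw [natDegree_pow, natDegree_C, mul_eq_zero] at h2
    exact h2.resolve_left (pow_ne_zero _ hp.ne_zero)
  exact hφ.expInvariants_eq_top hq hpq hj hw fun S hS hz ht => eq_top_of_mem (hS hx) (hS hy) hz ht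

theorem lemma3p6 {k : Type*} [Field k] (p : ℕ) (hp : 0 < p) [CharP k p]
    (m e s r q : ℕ) (hm : 1 < m) (hs : s = p ^ r * q) (hpq : ¬ p ∣ q) (hq : 1 < q)
    (hr : 1 ≤ r) (her : r < e) :
    ¬ ∃ φ : HypersurfaceRing k m s (p ^ e) →ₐ[k] (HypersurfaceRing k m s (p ^ e))[X],
      IsExponentialMap φ ∧ IsNontrivialExp φ ∧
        HypersurfaceRing.y k m s (p ^ e) ∈ expInvariants φ := by
  rintro ⟨φ, hφ, hnt, hy⟩
  have : Fact p.Prime := ⟨(CharP.char_is_prime_or_zero k p).resolve_right hp.ne'⟩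
  obtain ⟨j, rfl⟩ := Nat.exists_eq_add_of_le her.le
  subst hs
  exact hnt (HypersurfaceRing.expInvariants_eq_top hm hpq hq hr (by omega) hφ hy)
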